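/- Let Minkowski 3-space be $\mathbb{R}^3$ with the pseudo-scalar product $\langle u,v\rangle=u_0v_0+u_1v_1-u_2v_2$, and let $LC=\{p:\langle p,p\rangle=0\}$ be its light cone. For a closed set $F\subset\mathbb{R}^3$, its Möbius inversion is $$i_M(F)=\overline{\left\{\tfrac{p}{\langle p,p\rangle}: p\in F\setminus LC\right\}},$$ the closure being taken in the usual topology of $\mathbb{R}^3$. Let $p_0=(a,b,c)\in\mathbb{R}^3$ and $r>0$, let $S(p_0,r)$ be the Euclidean sphere with center $p_0$ and radius $r$, and put $S_M(p_0,r)=i_M(S(p_0,r))$. An ovaloid is a closed smooth regular surface $S\subset\mathbb{R}^3$ (that is, compact, connected and without boundary) which is strictly convex in the sense that it has contact $A_1^+$ with its tangent plane at every point: for every $p\in S$ and every non-zero vector $\nu$ normal to $T_pS$, the height function $q\mapsto\langle q-p,\nu\rangle$ on $S$ has at $p$ a Morse singularity (a nondegenerate critical point) of index $0$ or $2$. Then $S_M(p_0,r)$ is an ovaloid if and only if $$\sqrt{a^2+b^2}>2r+\sqrt{c^2+r^2}\qquad\text{or}\qquad |c|>2r+\sqrt{a^2+b^2+r^2}.$$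 -/

import Mathlib

open scoped ContDiff

/-- The vector space `ℝ³` with its usual topology. -/
abbrev R3 : Type := EuclideanSpace ℝ (Fin 3)

/-- The parameter plane `ℝ²`. -/
abbrev R2 : Type := EuclideanSpace ℝ (Fin 2)

/-- The pseudo-scalar product `⟨u, v⟩ = u₀ v₀ + u₁ v₁ - u₂ v₂` of Minkowski 3-space. -/
def minkowski (u v : R3) : ℝ := u 0 * v 0 + u 1 * v 1 - u 2 * v 2

/-- The light cone. -/
def lightCone : Set R3 := {p | minkowski p p = 0}

/-- The Möbius inversion of a set `F`: the topological closure of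
`{p / ⟨p, p⟩ : p ∈ F, p ∉ LC}`. -/
noncomputable def mobiusInversion (F : Set R3) : Set R3 :=
  closure ((fun p : R3 => (minkowski p p)⁻¹ • p) '' (F \ lightCone))

/-- `x : U → ℝ³` is a smooth regular local parametrization of `S`: it is smooth with injective
differential on the open set `U`, and a homeomorphism of `U` onto a relatively open part of `S`. -/
structure IsLocalParam (S : Set R3) (U : Set R2) (x : R2 → R3) : Prop where
  isOpen : IsOpen U
  smooth : ContDiffOn ℝ ∞ x U
  regular : ∀ u ∈ U, Function.Injective (fderiv ℝ x u)
  embedding : Topology.IsEmbedding (fun u : U => x u)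
  image_eq : ∃ V : Set R3, IsOpen V ∧ x '' U = S ∩ V

/-- A smooth regular (embedded) surface without boundary in `ℝ³`. -/
def IsRegularSurface (S : Set R3) : Prop :=
  ∀ p ∈ S, ∃ (U : Set R2) (x : R2 → R3), IsLocalParam S U x ∧ p ∈ x '' U

/-- The second derivative of `f` at `u`, as a bilinear form (the Hessian). -/
noncomputable def hessianForm (f : R2 → ℝ) (u : R2) (v w : R2) : ℝ :=
  fderiv ℝ (fderiv ℝ f) u v w

/-- `f` has a Morse singularity at `u`: a critical point with nondegenerate Hessian. -/
def IsMorseSingularity (f : R2 → ℝ) (u : R2) : Prop :=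
  fderiv ℝ f u = 0 ∧ ∀ v, (∀ w, hessianForm f u v w = 0) → v = 0

/-- The Morse index of `f` at `u`: the largest dimension of a subspace on which the Hessian is
negative definite. -/
noncomputable def morseIndex (f : R2 → ℝ) (u : R2) : ℕ :=
  sSup {k | ∃ W : Submodule ℝ R2, Module.finrank ℝ W = k ∧
    ∀ w ∈ W, w ≠ 0 → hessianForm f u w w < 0}

/-- `S` has contact `A₁⁺` with its tangent plane at `p`: in a local parametrization `x` of `S`
with `x u₀ = p`, the height function `q ↦ ⟨q - p, ν⟩` on `S`, where `ν ≠ 0` is normal to the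
tangent plane `range (dx u₀)`, has at `p` a Morse singularity of index `0` or `2`. -/
def HasA1PlusContact (S : Set R3) (p : R3) : Prop :=
  ∃ (U : Set R2) (x : R2 → R3) (u₀ : R2) (ν : R3),
    IsLocalParam S U x ∧ u₀ ∈ U ∧ x u₀ = p ∧
    ν ≠ 0 ∧ (∀ v : R2, minkowski (fderiv ℝ x u₀ v) ν = 0) ∧
    IsMorseSingularity (fun u => minkowski (x u - p) ν) u₀ ∧
    (morseIndex (fun u => minkowski (x u - p) ν) u₀ = 0 ∨
      morseIndex (fun u => minkowski (x u - p) ν) u₀ = 2)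

/-- An ovaloid: a closed (compact, connected, without boundary) smooth regular surface which is
strictly convex in the sense that it has contact `A₁⁺` with its tangent plane at every point. -/
structure IsOvaloid (S : Set R3) : Prop where
  surface : IsRegularSurface S
  compact : IsCompact S
  connected : IsConnected S
  contact : ∀ p ∈ S, HasA1PlusContact S p

/-!
The inversion `ι p = p / ⟨p, p⟩` is an involution off the light cone. If the sphere meets the light
cone, its inverse is unbounded: a bound would make the complement of the cone in the sphere both
open and closed (`minkowski_ne_zero_of_isCompact`). Otherwise the inverse is the image of the sphere
under a diffeomorphism, hence a compact connected regular surface, and only the contact with the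
tangent planes is in question.

Since `ι` maps planes to quadrics `⟨p, ν⟩ = d ⟨p, p⟩`, the height function `f` of the inverted
surface satisfies `f ⟨P, P⟩ = ⟨P, ν⟩ - d ⟨P, P⟩` in a parametrization `P` of the sphere. The second
derivatives of this relation and of `|P - p₀|² = r²` show that the Hessian of `f` at a critical zero
is a non-zero multiple of the quadratic form `contactForm`,
`e ↦ ⟨p, p⟩ |e|² - 2 (p · (p - p₀)) ⟨e, e⟩`, on the plane orthogonal to `p - p₀`
(`hessianForm_height`). A Morse singularity of index `0` or `2` is a critical point with definite
Hessian, so the inverted sphere is an ovaloid if and only if the sphere misses the light cone and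
this form is definite at each of its points (`isOvaloid_mobiusInversion_sphere_iff`).

On the tangent plane, `⟨e, e⟩ = |e|² - 2 e₂²` runs between its values on a horizontal and on a
steepest unit vector, so definiteness is a matter of two scalar inequalities at each point of the
sphere. Write `R = √(a² + b²)` and `C = |c|`. Outside the light cone the steepest direction at the
point of the sphere at the height of its center nearest to the axis is decisive and gives `(R - 2r)²
> C² + r²`; inside, it is the pole next to the plane of height zero, which gives `(C - 2r)² > R² +
r²`. The other branch of each square is excluded because the sphere misses the light cone, and
`steepest_value_pos` shows that the decisive inequality implies all the others.
-/

open Filter Topology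

/-! ### Second derivatives of functions of two variables -/

lemma hasFDerivAt_fderiv_of_contDiffAt {f : R2 → ℝ} {u : R2} (hf : ContDiffAt ℝ 2 f u) :
    HasFDerivAt (fderiv ℝ f) (fderiv ℝ (fderiv ℝ f) u) u :=
  ((hf.fderiv_right (m := 1) (by norm_num)).differentiableAt (by norm_num)).hasFDerivAt

lemma eventually_differentiableAt_of_contDiffAt {f : R2 → ℝ} {u : R2} (hf : ContDiffAt ℝ 2 f u) :
    ∀ᶠ t in 𝓝 u, DifferentiableAt ℝ f t :=
  (hf.eventually (by simp)).mono fun _ ht => ht.differentiableAt (by norm_num)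

lemma hessianForm_congr {f g : R2 → ℝ} {u : R2} (h : f =ᶠ[𝓝 u] g) (v w : R2) :
    hessianForm f u v w = hessianForm g u v w := by
  unfold hessianForm
  rw [h.fderiv.fderiv_eq]

lemma hessianForm_comm {f : R2 → ℝ} {u : R2} (hf : ContDiffAt ℝ 2 f u) (v w : R2) :
    hessianForm f u v w = hessianForm f u w v :=
  (hf.isSymmSndFDerivAt (by simp)).eq v w

lemma hessianForm_mul {f g : R2 → ℝ} {u : R2} (hf : ContDiffAt ℝ 2 f u) (hg : ContDiffAt ℝ 2 g u)
    (v w : R2) : hessianForm (fun t => f t * g t) u v w =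
      f u * hessianForm g u v w + fderiv ℝ f u v * fderiv ℝ g u w +
        (g u * hessianForm f u v w + fderiv ℝ g u v * fderiv ℝ f u w) := by
  have h1 : fderiv ℝ (fun t => f t * g t) =ᶠ[𝓝 u]
      fun t => f t • fderiv ℝ g t + g t • fderiv ℝ f t := by
    filter_upwards [eventually_differentiableAt_of_contDiffAt hf,
      eventually_differentiableAt_of_contDiffAt hg] with t h1 h2
    exact fderiv_fun_mul h1 h2
  have h2 := ((hf.differentiableAt (by norm_num)).hasFDerivAt.smul
    (hasFDerivAt_fderiv_of_contDiffAt hg)).add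
    ((hg.differentiableAt (by norm_num)).hasFDerivAt.smul (hasFDerivAt_fderiv_of_contDiffAt hf))
  unfold hessianForm
  rw [h1.fderiv_eq]
  exact congrArg (fun T : R2 →L[ℝ] R2 →L[ℝ] ℝ => T v w) h2.fderiv

lemma fderiv_quadratic {P : Fin 3 → R2 → ℝ} {u : R2} (hP : ∀ i, DifferentiableAt ℝ (P i) u)
    (c l : Fin 3 → ℝ) (k : ℝ) :
    fderiv ℝ (fun t => ∑ i, (c i * P i t ^ 2 + l i * P i t) + k) u =
      ∑ i, (2 * c i * P i u + l i) • fderiv ℝ (P i) u := by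
  have h : HasFDerivAt (fun t => ∑ i, (c i * P i t ^ 2 + l i * P i t) + k)
      (∑ i, (c i • ((2 : ℕ) * P i u ^ (2 - 1)) • fderiv ℝ (P i) u + l i • fderiv ℝ (P i) u)) u := by
    refine HasFDerivAt.add_const _ (HasFDerivAt.fun_sum fun i _ => ?_)
    refine HasFDerivAt.add ?_ ((hP i).hasFDerivAt.const_mul _)
    simpa [mul_smul] using ((hP i).hasFDerivAt.pow 2).const_mul (c i)
  rw [h.fderiv]
  refine Finset.sum_congr rfl fun i _ => ?_
  ext v
  simp
  ring

lemma hessianForm_quadratic {P : Fin 3 → R2 → ℝ} {u : R2} (hP : ∀ i, ContDiffAt ℝ 2 (P i) u)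
    (c l : Fin 3 → ℝ) (k : ℝ) (v w : R2) :
    hessianForm (fun t => ∑ i, (c i * P i t ^ 2 + l i * P i t) + k) u v w =
      ∑ i, (2 * c i * (fderiv ℝ (P i) u v * fderiv ℝ (P i) u w) +
        (2 * c i * P i u + l i) * hessianForm (P i) u v w) := by
  have h1 : fderiv ℝ (fun t => ∑ i, (c i * P i t ^ 2 + l i * P i t) + k) =ᶠ[𝓝 u]
      fun t => ∑ i, (2 * c i * P i t + l i) • fderiv ℝ (P i) t := by
    filter_upwards [eventually_all.2 fun i =>
      eventually_differentiableAt_of_contDiffAt (hP i)] with t ht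
    exact fderiv_quadratic ht c l k
  have h2 : HasFDerivAt (fun t => ∑ i, (2 * c i * P i t + l i) • fderiv ℝ (P i) t)
      (∑ i, ((2 * c i * P i u + l i) • fderiv ℝ (fderiv ℝ (P i)) u +
        ((2 * c i) • fderiv ℝ (P i) u).smulRight (fderiv ℝ (P i) u))) u := by
    refine HasFDerivAt.fun_sum fun i _ => ?_
    have h3 : HasFDerivAt (fun t => 2 * c i * P i t + l i) ((2 * c i) • fderiv ℝ (P i) u) u :=
      (((hP i).differentiableAt (by norm_num)).hasFDerivAt.const_mul _).add_const _
    exact h3.smul (hasFDerivAt_fderiv_of_contDiffAt (hP i))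
  unfold hessianForm
  rw [h1.fderiv_eq, h2.fderiv]
  simp only [sum_apply, add_apply, smul_apply,
    ContinuousLinearMap.smulRight_apply, smul_eq_mul]
  refine Finset.sum_congr rfl fun i _ => ?_
  ring

/-- A Morse singularity of index `0` or `2` in the plane is a critical point with definite
Hessian. -/
lemma isMorseSingularity_and_index_iff {f : R2 → ℝ} {u : R2} (hf : ContDiffAt ℝ 2 f u) :
    (IsMorseSingularity f u ∧ (morseIndex f u = 0 ∨ morseIndex f u = 2)) ↔
      fderiv ℝ f u = 0 ∧ ((∀ v, v ≠ 0 → 0 < hessianForm f u v v) ∨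
        (∀ v, v ≠ 0 → hessianForm f u v v < 0)) := by
  set I := {k | ∃ W : Submodule ℝ R2, Module.finrank ℝ W = k ∧
    ∀ w ∈ W, w ≠ 0 → hessianForm f u w w < 0} with hI
  have hdim : Module.finrank ℝ R2 = 2 := by simp [R2]
  have hbdd : BddAbove I := ⟨2, by
    rintro k ⟨W, rfl, -⟩
    exact W.finrank_le.trans_eq hdim⟩
  have hne : I.Nonempty := ⟨0, ⊥, by simp, by simp⟩
  have hidx : morseIndex f u = sSup I := rfl
  constructor
  · rintro ⟨⟨h0, hnd⟩, h | h⟩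
    · refine ⟨h0, Or.inl fun v hv => ?_⟩
      have hnn : ∀ w, 0 ≤ hessianForm f u w w := by
        intro w
        by_contra! hw
        have hw0 : w ≠ 0 := by
          rintro rfl
          simp [hessianForm] at hw
        have : 1 ∈ I := by
          refine ⟨Submodule.span ℝ {w}, finrank_span_singleton hw0, ?_⟩
          intro y hy hy0
          obtain ⟨s, rfl⟩ := Submodule.mem_span_singleton.1 hy
          have hs : s ≠ 0 := by
            rintro rfl
            simp at hy0
          have : hessianForm f u (s • w) (s • w) = s ^ 2 * hessianForm f u w w := by
            simp [hessianForm]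
            ring
          rw [this]
          exact mul_neg_of_pos_of_neg (by positivity) hw
        have := le_csSup hbdd this
        omega
      refine lt_of_le_of_ne (hnn v) fun hv0 => hv (hnd v fun w => ?_)
      -- A null vector of a semidefinite form lies in its kernel.
      have hq : ∀ t : ℝ, 0 ≤ hessianForm f u w w * (t * t) + 2 * hessianForm f u v w * t + 0 := by
        intro t
        have h1 := hnn (v + t • w)
        have h2 : hessianForm f u (v + t • w) (v + t • w) = hessianForm f u v v +
            t * hessianForm f u v w + t * hessianForm f u w v + t * t * hessianForm f u w w := by
          simp [hessianForm]
          ring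
        rw [h2, hessianForm_comm hf w v, ← hv0] at h1
        linarith
      have := discrim_le_zero hq
      unfold discrim at this
      have h3 : (2 * hessianForm f u v w) ^ 2 ≤ 0 := by linarith
      have h4 := pow_eq_zero_iff (two_ne_zero) |>.1 (le_antisymm h3 (sq_nonneg _))
      linarith
    · refine ⟨h0, Or.inr fun v hv => ?_⟩
      obtain ⟨W, hW, hneg⟩ : 2 ∈ I := by
        rw [← h, hidx]
        exact Nat.sSup_mem hne hbdd
      have : W = ⊤ := Submodule.eq_top_of_finrank_eq (hW.trans hdim.symm)
      exact hneg v (this ▸ Submodule.mem_top) hv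
  · rintro ⟨h0, h | h⟩
    · refine ⟨⟨h0, fun v hv => ?_⟩, Or.inl ?_⟩
      · by_contra hv0
        exact (h v hv0).ne' (hv v)
      · rw [hidx]
        refine Nat.le_zero.1 (csSup_le hne ?_)
        rintro k ⟨W, rfl, hW⟩
        have : W = ⊥ := (Submodule.eq_bot_iff _).2 fun w hw => by
          by_contra hw0
          exact (h w hw0).not_gt (hW w hw hw0)
        simp [this]
    · refine ⟨⟨h0, fun v hv => ?_⟩, Or.inr ?_⟩
      · by_contra hv0
        exact (h v hv0).ne (hv v)
      · rw [hidx]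
        refine le_antisymm (csSup_le hne ?_) (le_csSup hbdd ⟨⊤, by simp, fun w _ => h w⟩)
        rintro k ⟨W, rfl, -⟩
        exact W.finrank_le.trans_eq hdim

/-! ### The Möbius inversion of a sphere -/

/-- The inversion `p ↦ p / ⟨p, p⟩` as a map of `ℝ³`; on the light cone it takes the value `0`. -/
noncomputable def minkowskiInversion (p : R3) : R3 := (minkowski p p)⁻¹ • p

lemma contDiff_minkowski_self : ContDiff ℝ ∞ fun p : R3 => minkowski p p := by
  unfold minkowski
  fun_prop

lemma continuous_minkowski_self : Continuous fun p : R3 => minkowski p p :=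
  contDiff_minkowski_self.continuous

lemma contDiffAt_minkowskiInversion {p : R3} (hp : minkowski p p ≠ 0) :
    ContDiffAt ℝ ∞ minkowskiInversion p :=
  (contDiff_minkowski_self.contDiffAt.inv hp).smul contDiffAt_id

lemma minkowski_smul_smul (s : ℝ) (p : R3) : minkowski (s • p) (s • p) = s ^ 2 * minkowski p p := by
  simp [minkowski]
  ring

lemma minkowski_minkowskiInversion (p : R3) :
    minkowski (minkowskiInversion p) (minkowskiInversion p) = (minkowski p p)⁻¹ := by
  rw [minkowskiInversion, minkowski_smul_smul]
  by_cases h : minkowski p p = 0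
  · simp [h]
  · field_simp

lemma minkowskiInversion_minkowskiInversion {p : R3} (hp : minkowski p p ≠ 0) :
    minkowskiInversion (minkowskiInversion p) = p := by
  rw [minkowskiInversion, minkowski_minkowskiInversion, inv_inv, minkowskiInversion, smul_smul,
    mul_inv_cancel₀ hp, one_smul]

lemma abs_minkowski_self_le (p : R3) : |minkowski p p| ≤ ‖p‖ ^ 2 := by
  rw [EuclideanSpace.real_norm_sq_eq, Fin.sum_univ_three, abs_le, minkowski]
  constructor <;> nlinarith [sq_nonneg (p 0), sq_nonneg (p 1), sq_nonneg (p 2)]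

lemma norm_sq_fin_three (p : R3) : ‖p‖ ^ 2 = p 0 ^ 2 + p 1 ^ 2 + p 2 ^ 2 := by
  rw [EuclideanSpace.real_norm_sq_eq, Fin.sum_univ_three]

lemma mem_sphere_iff_coord {p p₀ : R3} {r : ℝ} (hr : 0 ≤ r) : p ∈ Metric.sphere p₀ r ↔
    (p 0 - p₀ 0) ^ 2 + (p 1 - p₀ 1) ^ 2 + (p 2 - p₀ 2) ^ 2 = r ^ 2 := by
  rw [mem_sphere_iff_norm, ← sq_eq_sq₀ (norm_nonneg _) hr, norm_sq_fin_three]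
  simp

lemma isConnected_sphere_R3 (p₀ : R3) {r : ℝ} (hr : 0 ≤ r) : IsConnected (Metric.sphere p₀ r) := by
  refine isConnected_sphere ?_ p₀ hr
  rw [← Module.finrank_eq_rank]
  norm_num [R3]

/-- A sphere does not lie in the light cone: the ends of a horizontal and of a vertical diameter
cannot all be null. -/
lemma exists_mem_sphere_minkowski_ne_zero (p₀ : R3) {r : ℝ} (hr : 0 < r) :
    ∃ p ∈ Metric.sphere p₀ r, minkowski p p ≠ 0 := by
  by_contra! h
  have h1 (s : ℝ) (hs : s ^ 2 = r ^ 2) : (p₀ 0 + s) ^ 2 + p₀ 1 ^ 2 - p₀ 2 ^ 2 = 0 := by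
    have := h !₂[p₀ 0 + s, p₀ 1, p₀ 2] ((mem_sphere_iff_coord hr.le).2 (by simpa using hs))
    simp [minkowski] at this
    linarith
  have h2 (s : ℝ) (hs : s ^ 2 = r ^ 2) : p₀ 0 ^ 2 + p₀ 1 ^ 2 - (p₀ 2 + s) ^ 2 = 0 := by
    have := h !₂[p₀ 0, p₀ 1, p₀ 2 + s] ((mem_sphere_iff_coord hr.le).2 (by simpa using hs))
    simp [minkowski] at this
    linarith
  have := h1 r rfl
  have := h1 (-r) (by ring)
  have := h2 r rfl
  have := h2 (-r) (by ring)
  have : 0 < r ^ 2 := by positivity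
  nlinarith

/-- If the inverse of a sphere is bounded, the sphere misses the light cone. The bound `M` turns
the complement of the light cone in the sphere into a set which is closed as well as open, and a
sphere is connected. -/
lemma minkowski_ne_zero_of_isCompact {p₀ : R3} {r : ℝ} (hr : 0 < r)
    (hc : IsCompact (mobiusInversion (Metric.sphere p₀ r))) :
    ∀ p ∈ Metric.sphere p₀ r, minkowski p p ≠ 0 := by
  obtain ⟨M, hM0, hM⟩ := hc.isBounded.exists_pos_norm_le
  set A : Set R3 := {p | ‖p‖ ≤ M * |minkowski p p|} ∩ {p | 1 ≤ M * ‖p‖}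
  have hAc : IsClosed A := (isClosed_le continuous_norm
    (continuous_const.mul continuous_minkowski_self.abs)).inter
    (isClosed_le continuous_const (continuous_const.mul continuous_norm))
  have hAQ : ∀ p ∈ A, minkowski p p ≠ 0 := by
    rintro p ⟨h1, h2⟩ h0
    simp only [Set.mem_ofPred_eq, h0, abs_zero, mul_zero] at h1 h2
    have : ‖p‖ = 0 := le_antisymm h1 (norm_nonneg _)
    rw [this] at h2
    norm_num at h2
  have hQA : ∀ p ∈ Metric.sphere p₀ r, minkowski p p ≠ 0 → p ∈ A := by
    intro p hp h0
    have h1 := hM _ (subset_closure ⟨p, ⟨hp, h0⟩, rfl⟩)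
    have hpos : 0 < |minkowski p p| := abs_pos.2 h0
    have h2 : ‖p‖ ≤ M * |minkowski p p| := by
      rw [norm_smul, norm_inv, Real.norm_eq_abs, inv_mul_eq_div, div_le_iff₀ hpos] at h1
      exact h1
    refine ⟨h2, ?_⟩
    have hp0 : 0 < ‖p‖ := norm_pos_iff.2 fun h => h0 (by simp [h, minkowski])
    have h3 := mul_le_mul_of_nonneg_left (abs_minkowski_self_le p) hM0.le
    refine le_of_mul_le_mul_right ?_ hp0
    show 1 * ‖p‖ ≤ M * ‖p‖ * ‖p‖
    linarith
  have hpre := (isConnected_sphere_R3 p₀ hr.le).isPreconnected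
  intro p hp
  by_contra h0
  obtain ⟨p', hp', h0'⟩ := exists_mem_sphere_minkowski_ne_zero p₀ hr
  obtain ⟨y, hy, hy1, hy2⟩ := hpre {p | minkowski p p ≠ 0} Aᶜ
    (isOpen_ne_fun continuous_minkowski_self continuous_const) hAc.isOpen_compl
    (fun y _ => by
      by_cases h : y ∈ A
      · exact Or.inl (hAQ y h)
      · exact Or.inr h) ⟨p', hp', h0'⟩ ⟨p, hp, fun h => hAQ p h h0⟩
  exact hy2 (hQA y hy hy1)

lemma isCompact_image_minkowskiInversion {p₀ : R3} {r : ℝ}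
    (h0 : ∀ p ∈ Metric.sphere p₀ r, minkowski p p ≠ 0) :
    IsCompact (minkowskiInversion '' Metric.sphere p₀ r) :=
  (isCompact_sphere p₀ r).image_of_continuousOn fun p hp =>
    (contDiffAt_minkowskiInversion (h0 p hp)).continuousAt.continuousWithinAt

lemma mobiusInversion_sphere_eq_image {p₀ : R3} {r : ℝ}
    (h0 : ∀ p ∈ Metric.sphere p₀ r, minkowski p p ≠ 0) :
    mobiusInversion (Metric.sphere p₀ r) = minkowskiInversion '' Metric.sphere p₀ r := by
  have : Metric.sphere p₀ r \ lightCone = Metric.sphere p₀ r :=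
    sdiff_eq_left.2 (Set.disjoint_left.2 h0)
  rw [mobiusInversion, this]
  exact (isCompact_image_minkowskiInversion h0).isClosed.closure_eq

lemma mem_image_minkowskiInversion_iff {p₀ : R3} {r : ℝ}
    (h0 : ∀ p ∈ Metric.sphere p₀ r, minkowski p p ≠ 0) {q : R3} :
    q ∈ minkowskiInversion '' Metric.sphere p₀ r ↔
      minkowski q q ≠ 0 ∧ minkowskiInversion q ∈ Metric.sphere p₀ r := by
  constructor
  · rintro ⟨p, hp, rfl⟩
    rw [minkowski_minkowskiInversion, minkowskiInversion_minkowskiInversion (h0 p hp)]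
    exact ⟨inv_ne_zero (h0 p hp), hp⟩
  · rintro ⟨h1, h2⟩
    exact ⟨_, h2, minkowskiInversion_minkowskiInversion h1⟩

/-! ### Contact of an inverted sphere with its tangent planes -/

/-- The quadratic form `e ↦ ⟨p, p⟩ |e|² - 2 (p · (p - p₀)) ⟨e, e⟩`, with `·` the Euclidean scalar
product. On the tangent plane at `p` of a sphere with center `p₀` it is, up to a non-zero factor,
the second fundamental form of the inverted sphere. -/
noncomputable def contactForm (p₀ p e : R3) : ℝ :=
  minkowski p p * ‖e‖ ^ 2 - 2 * inner ℝ p (p - p₀) * minkowski e e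

lemma inner_fin_three (p q : R3) : inner ℝ p q = p 0 * q 0 + p 1 * q 1 + p 2 * q 2 := by
  simp [PiLp.inner_apply, Fin.sum_univ_three, mul_comm]

/-- The signs of the Minkowski product. -/
def minkowskiSign (i : Fin 3) : ℝ := if i = 2 then -1 else 1

lemma minkowski_eq_sum (u v : R3) : minkowski u v = ∑ i, minkowskiSign i * (u i * v i) := by
  simp [minkowski, minkowskiSign, Fin.sum_univ_three]
  ring

lemma contDiffAt_coord {P : R2 → R3} {u : R2} {n : WithTop ℕ∞} (hP : ContDiffAt ℝ n P u)
    (i : Fin 3) : ContDiffAt ℝ n (fun t => P t i) u :=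
  contDiffAt_euclidean.1 hP i

lemma fderiv_coord {P : R2 → R3} {u : R2} (hP : DifferentiableAt ℝ P u) (i : Fin 3) (v : R2) :
    fderiv ℝ (fun t => P t i) u v = fderiv ℝ P u v i := by
  have := ((EuclideanSpace.proj (𝕜 := ℝ) i).hasFDerivAt.comp u hP.hasFDerivAt).fderiv
  exact congrArg (fun T : R2 →L[ℝ] ℝ => T v) this

/-- The tangent vectors and the second derivatives of a map into a sphere. -/
lemma sphere_valued_derivatives {P : R2 → R3} {u : R2} {p₀ : R3} {r : ℝ} (hr : 0 ≤ r)
    (hP : ContDiffAt ℝ 2 P u) (hS : ∀ᶠ t in 𝓝 u, P t ∈ Metric.sphere p₀ r) (v w : R2) :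
    inner ℝ (P u - p₀) (fderiv ℝ P u v) = 0 ∧
      ∑ i, (P u i - p₀ i) * hessianForm (fun t => P t i) u v w =
        -inner ℝ (fderiv ℝ P u v) (fderiv ℝ P u w) := by
  have hc := contDiffAt_coord hP
  have hd := hP.differentiableAt (n := 2) (by norm_num)
  have h : (fun t => ∑ i, ((1 : ℝ) * P t i ^ 2 + (-2 * p₀ i) * P t i) +
      (p₀ 0 ^ 2 + p₀ 1 ^ 2 + p₀ 2 ^ 2)) =ᶠ[𝓝 u] fun _ => r ^ 2 := by
    filter_upwards [hS] with t ht
    rw [← (mem_sphere_iff_coord hr).1 ht, Fin.sum_univ_three]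
    ring
  have hcd (i : Fin 3) := (hc i).differentiableAt (by norm_num)
  have h1 := h.fderiv_eq (𝕜 := ℝ)
  rw [fderiv_quadratic (P := fun i t => P t i) hcd
    (fun _ => 1) (fun i => -2 * p₀ i)] at h1
  have h1 := congrArg (fun T : R2 →L[ℝ] ℝ => T v) h1
  have h2 := hessianForm_congr h v w
  rw [hessianForm_quadratic (P := fun i t => P t i) hc (fun _ => 1) (fun i => -2 * p₀ i)] at h2
  have h3 : hessianForm (fun _ => r ^ 2) u v w = 0 := by
    have : fderiv ℝ (fun _ : R2 => r ^ 2) = fun _ => 0 := by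
      ext1 t
      simp
    simp [hessianForm, this]
  rw [h3] at h2
  simp only [fderiv_coord hd, Fin.sum_univ_three, add_apply, smul_apply, smul_eq_mul,
    fderiv_fun_const, Pi.zero_apply, zero_apply] at h1 h2
  rw [inner_fin_three, inner_fin_three, Fin.sum_univ_three]
  simp only [PiLp.sub_apply]
  constructor <;> linarith

/-- The height function `f` of an inverted surface, multiplied by `⟨P, P⟩`, is a quadratic function
of the surface `P`. At a zero of `f` this relation gives the first derivative of `f`. -/
lemma fderiv_height {P : R2 → R3} {u : R2} {ν : R3} {d : ℝ} {f : R2 → ℝ}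
    (hP : ContDiffAt ℝ 2 P u) (hf : ContDiffAt ℝ 2 f u) (hfu : f u = 0)
    (hfP : ∀ᶠ t in 𝓝 u, f t * minkowski (P t) (P t) = minkowski (P t) ν - d * minkowski (P t) (P t))
    (v : R2) :
    fderiv ℝ f u v * minkowski (P u) (P u) =
      ∑ i, minkowskiSign i * (ν i - 2 * d * P u i) * fderiv ℝ P u v i := by
  have hc := contDiffAt_coord hP
  have hd := hP.differentiableAt (n := 2) (by norm_num)
  have hQ : ContDiffAt ℝ 2 (fun t => minkowski (P t) (P t)) u :=
    (contDiff_minkowski_self.contDiffAt.of_le ENat.LEInfty.out).comp u hP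
  have h : (fun t => f t * minkowski (P t) (P t)) =ᶠ[𝓝 u] fun t =>
      ∑ i, ((-d * minkowskiSign i) * P t i ^ 2 + (minkowskiSign i * ν i) * P t i) + 0 := by
    filter_upwards [hfP] with t ht
    rw [ht]
    simp only [minkowski_eq_sum, Fin.sum_univ_three]
    ring
  have hcd (i : Fin 3) := (hc i).differentiableAt (by norm_num)
  have h1 := h.fderiv_eq (𝕜 := ℝ)
  rw [fderiv_quadratic (P := fun i t => P t i) hcd
    (fun i => -d * minkowskiSign i) (fun i => minkowskiSign i * ν i),
    fderiv_fun_mul (hf.differentiableAt (by norm_num)) (hQ.differentiableAt (by norm_num)),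
    hfu] at h1
  have h1 := congrArg (fun T : R2 →L[ℝ] ℝ => T v) h1
  simp only [fderiv_coord hd, Fin.sum_univ_three, add_apply, smul_apply, smul_eq_mul] at h1
  rw [Fin.sum_univ_three]
  linarith

/-- Along a sphere, the Hessian of the height function at a critical zero, when the vector
`(ν₀, ν₁, -ν₂) - 2 d (P₀, P₁, -P₂)` equals `l (P - p₀)`. -/
lemma hessianForm_height {P : R2 → R3} {u : R2} {p₀ ν : R3} {d l r : ℝ} {f : R2 → ℝ} (hr : 0 ≤ r)
    (hP : ContDiffAt ℝ 2 P u) (hf : ContDiffAt ℝ 2 f u) (hfu : f u = 0) (hfu' : fderiv ℝ f u = 0)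
    (hS : ∀ᶠ t in 𝓝 u, P t ∈ Metric.sphere p₀ r)
    (hfP : ∀ᶠ t in 𝓝 u, f t * minkowski (P t) (P t) = minkowski (P t) ν - d * minkowski (P t) (P t))
    (hν : ∀ i, minkowskiSign i * (ν i - 2 * d * P u i) = l * (P u i - p₀ i)) (v w : R2) :
    hessianForm f u v w * minkowski (P u) (P u) =
      -2 * d * minkowski (fderiv ℝ P u v) (fderiv ℝ P u w) -
        l * inner ℝ (fderiv ℝ P u v) (fderiv ℝ P u w) := by
  have hc := contDiffAt_coord hP
  have hd := hP.differentiableAt (n := 2) (by norm_num)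
  have hQ : ContDiffAt ℝ 2 (fun t => minkowski (P t) (P t)) u :=
    (contDiff_minkowski_self.contDiffAt.of_le ENat.LEInfty.out).comp u hP
  have h : (fun t => f t * minkowski (P t) (P t)) =ᶠ[𝓝 u] fun t =>
      ∑ i, ((-d * minkowskiSign i) * P t i ^ 2 + (minkowskiSign i * ν i) * P t i) + 0 := by
    filter_upwards [hfP] with t ht
    rw [ht]
    simp only [minkowski_eq_sum, Fin.sum_univ_three]
    ring
  have h2 := hessianForm_congr h v w
  rw [hessianForm_quadratic (P := fun i t => P t i) hc
    (fun i => -d * minkowskiSign i) (fun i => minkowskiSign i * ν i),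
    hessianForm_mul hf hQ, hfu, hfu'] at h2
  have h3 := (sphere_valued_derivatives hr hP hS v w).2
  simp only [Fin.sum_univ_three] at h3
  simp only [fderiv_coord hd, zero_apply] at h2
  rw [eq_neg_iff_add_eq_zero] at h3
  have e (i : Fin 3) : 2 * (-d * minkowskiSign i) * P u i + minkowskiSign i * ν i =
      l * (P u i - p₀ i) := by
    rw [← hν]
    ring
  simp only [e, Fin.sum_univ_three] at h2
  rw [minkowski_eq_sum (fderiv ℝ P u v), Fin.sum_univ_three]
  linear_combination h2 + l * h3

lemma exists_eq_smul_of_forall_inner_eq_zero {n w : R3}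
    (h : ∀ e : R3, inner ℝ n e = 0 → inner ℝ w e = 0) : ∃ l : ℝ, w = l • n := by
  have : w ∈ (ℝ ∙ n)ᗮᗮ := (Submodule.mem_orthogonal' _ _).2 fun e he =>
    h e (Submodule.mem_orthogonal_singleton_iff_inner_right.1 he)
  rw [Submodule.orthogonal_orthogonal] at this
  obtain ⟨l, hl⟩ := Submodule.mem_span_singleton.1 this
  exact ⟨l, hl.symm⟩

/-- An injective linear map from the plane into the orthogonal complement of `n ≠ 0` is onto. -/
lemma exists_eq_of_inner_eq_zero {T : R2 →L[ℝ] R3} {n : R3} (hn : n ≠ 0)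
    (hT : Function.Injective T) (hTn : ∀ v, inner ℝ n (T v) = 0) {e : R3} (he : inner ℝ n e = 0) :
    ∃ v, T v = e := by
  have hle : LinearMap.range (T : R2 →ₗ[ℝ] R3) ≤ (ℝ ∙ n)ᗮ := by
    rintro _ ⟨v, rfl⟩
    exact Submodule.mem_orthogonal_singleton_iff_inner_right.2 (hTn v)
  have hdim : Module.finrank ℝ (LinearMap.range (T : R2 →ₗ[ℝ] R3)) =
      Module.finrank ℝ (ℝ ∙ n)ᗮ := by
    rw [LinearMap.finrank_range_of_inj hT]
    have : Fact (Module.finrank ℝ R3 = 2 + 1) := ⟨by simp [R3]⟩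
    rw [Submodule.finrank_orthogonal_span_singleton (n := 2) hn]
    simp [R2]
  have : e ∈ LinearMap.range (T : R2 →ₗ[ℝ] R3) := by
    rw [Submodule.eq_of_le_of_finrank_eq hle hdim]
    exact Submodule.mem_orthogonal_singleton_iff_inner_right.2 he
  exact this

section LocalParam

variable {p₀ : R3} {r : ℝ} {U : Set R2} {x : R2 → R3} {u : R2}

/-- Facts about a local parametrization `x` of the inverted sphere and the corresponding
parametrization `P` of the sphere. -/
lemma IsLocalParam.inverse_param (hr : 0 < r)
    (h0 : ∀ p ∈ Metric.sphere p₀ r, minkowski p p ≠ 0)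
    (hx : IsLocalParam (minkowskiInversion '' Metric.sphere p₀ r) U x) (hu : u ∈ U) :
    ContDiffAt ℝ ∞ x u ∧ ContDiffAt ℝ ∞ (fun t => minkowskiInversion (x t)) u ∧
      (∀ᶠ t in 𝓝 u, minkowskiInversion (x t) ∈ Metric.sphere p₀ r) ∧
      (∀ᶠ t in 𝓝 u, minkowski (x t) (x t) ≠ 0) ∧
      (∀ v, inner ℝ (minkowskiInversion (x u) - p₀)
        (fderiv ℝ (fun t => minkowskiInversion (x t)) u v) = 0) ∧
      Function.Injective (fderiv ℝ (fun t => minkowskiInversion (x t)) u) ∧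
      ∀ e, inner ℝ (minkowskiInversion (x u) - p₀) e = 0 →
        ∃ v, fderiv ℝ (fun t => minkowskiInversion (x t)) u v = e := by
  have hmem : ∀ t ∈ U, x t ∈ minkowskiInversion '' Metric.sphere p₀ r := by
    intro t ht
    obtain ⟨V, -, hV⟩ := hx.image_eq
    exact (hV ▸ Set.mem_image_of_mem x ht : x t ∈ _ ∩ V).1
  have hU := hx.isOpen.mem_nhds hu
  have hxc : ContDiffAt ℝ ∞ x u := hx.smooth.contDiffAt hU
  have hev : ∀ᶠ t in 𝓝 u, minkowski (x t) (x t) ≠ 0 ∧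
      minkowskiInversion (x t) ∈ Metric.sphere p₀ r :=
    eventually_of_mem hU fun t ht => (mem_image_minkowskiInversion_iff h0).1 (hmem t ht)
  have hPc : ContDiffAt ℝ ∞ (fun t => minkowskiInversion (x t)) u :=
    (contDiffAt_minkowskiInversion hev.self_of_nhds.1).comp u hxc
  have htan : ∀ v, inner ℝ (minkowskiInversion (x u) - p₀)
      (fderiv ℝ (fun t => minkowskiInversion (x t)) u v) = 0 := fun v =>
    (sphere_valued_derivatives hr.le (hPc.of_le ENat.LEInfty.out)
      (hev.mono fun _ h => h.2) v v).1
  have hinj : Function.Injective (fderiv ℝ (fun t => minkowskiInversion (x t)) u) := by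
    have h1 : x =ᶠ[𝓝 u] minkowskiInversion ∘ fun t => minkowskiInversion (x t) := by
      filter_upwards [hev] with t ht
      exact (minkowskiInversion_minkowskiInversion ht.1).symm
    have h2 := h1.fderiv_eq (𝕜 := ℝ)
    rw [fderiv_comp u ((contDiffAt_minkowskiInversion
      (h0 _ hev.self_of_nhds.2)).differentiableAt (by simp)) (hPc.differentiableAt (by simp))] at h2
    have h3 := hx.regular u hu
    rw [h2] at h3
    exact Function.Injective.of_comp h3
  have hn : minkowskiInversion (x u) - p₀ ≠ 0 := by
    rw [← norm_pos_iff, mem_sphere_iff_norm.1 hev.self_of_nhds.2]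
    exact hr
  exact ⟨hxc, hPc, hev.mono fun _ h => h.2, hev.mono fun _ h => h.1, htan, hinj,
    fun e he => exists_eq_of_inner_eq_zero hn hinj htan he⟩

/-- Definiteness of the contact form on the plane tangent at `p` to a sphere with center `p₀`. -/
def HasDefiniteContactForm (p₀ p : R3) : Prop :=
  (∀ e, e ≠ 0 → inner ℝ (p - p₀) e = 0 → 0 < contactForm p₀ p e) ∨
    ∀ e, e ≠ 0 → inner ℝ (p - p₀) e = 0 → contactForm p₀ p e < 0

lemma height_eq {t : R2} {q ν : R3} :
    minkowski (x t - q) ν * minkowski (minkowskiInversion (x t)) (minkowskiInversion (x t)) =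
      minkowski (minkowskiInversion (x t)) ν - minkowski q ν *
        minkowski (minkowskiInversion (x t)) (minkowskiInversion (x t)) := by
  rw [minkowski_minkowskiInversion]
  have : minkowski (minkowskiInversion (x t)) ν =
      (minkowski (x t) (x t))⁻¹ * minkowski (x t) ν := by
    simp [minkowskiInversion, minkowski]
    ring
  rw [this]
  simp [minkowski]
  ring

lemma contDiffAt_height {q ν : R3} (hx : ContDiffAt ℝ ∞ x u) :
    ContDiffAt ℝ 2 (fun t => minkowski (x t - q) ν) u := by
  have hc := contDiffAt_coord (hx.of_le (m := 2) ENat.LEInfty.out)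
  have h0 := hc 0
  have h1 := hc 1
  have h2 := hc 2
  simp only [minkowski, PiLp.sub_apply]
  fun_prop

/-- Contact `A₁⁺` makes the contact form definite. -/
lemma HasA1PlusContact.hasDefiniteContactForm (hr : 0 < r)
    (h0 : ∀ p ∈ Metric.sphere p₀ r, minkowski p p ≠ 0) {q : R3}
    (h : HasA1PlusContact (minkowskiInversion '' Metric.sphere p₀ r) q) :
    HasDefiniteContactForm p₀ (minkowskiInversion q) := by
  obtain ⟨U, x, u, ν, hx, hu, rfl, hν0, -, hM, hI⟩ := h
  obtain ⟨hxc, hPc, hPS, hx0, htan, -, hsurj⟩ := hx.inverse_param hr h0 hu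
  have hf := contDiffAt_height (q := x u) (ν := ν) hxc
  obtain ⟨hf', hdef⟩ := (isMorseSingularity_and_index_iff hf).1 ⟨hM, hI⟩
  have hP2 := hPc.of_le (m := 2) ENat.LEInfty.out
  have hfP : ∀ᶠ t in 𝓝 u, _ := Eventually.of_forall fun t =>
    height_eq (x := x) (t := t) (q := x u) (ν := ν)
  have hfu : minkowski (x u - x u) ν = 0 := by simp [minkowski]
  have hQ := h0 _ hPS.self_of_nhds
  set P := fun t => minkowskiInversion (x t)
  change HasDefiniteContactForm p₀ (P u)
  set d := minkowski (x u) ν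
  -- The critical point condition says that `w` is normal to the sphere.
  set w : R3 := WithLp.toLp 2 fun i => minkowskiSign i * (ν i - 2 * d * P u i)
  obtain ⟨l, hl⟩ : ∃ l : ℝ, w = l • (P u - p₀) := by
    refine exists_eq_smul_of_forall_inner_eq_zero fun e he => ?_
    obtain ⟨v, rfl⟩ := hsurj e he
    have := fderiv_height hP2 hf hfu hfP v
    rw [hf', zero_apply, zero_mul, Fin.sum_univ_three] at this
    rw [inner_fin_three]
    exact this.symm
  have hl' : ∀ i, minkowskiSign i * (ν i - 2 * d * P u i) = l * (P u i - p₀ i) := fun i =>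
    congrArg (fun y : R3 => y i) hl
  have hdQ : d * minkowski (P u) (P u) = -l * inner ℝ (P u) (P u - p₀) := by
    have h1 : d * minkowski (P u) (P u) = minkowski (P u) ν := by
      have := hfP.self_of_nhds
      rw [hfu] at this
      linarith
    have h2 := hl' 0
    have h3 := hl' 1
    have h4 := hl' 2
    simp [minkowskiSign] at h2 h3 h4
    rw [inner_fin_three]
    simp only [minkowski, PiLp.sub_apply] at h1 ⊢
    linear_combination (-1) * h1 - P u 0 * h2 - P u 1 * h3 - P u 2 * h4
  have hl0 : l ≠ 0 := by
    rintro rfl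
    have hd0 : d = 0 := by
      rw [neg_zero, zero_mul] at hdQ
      exact (mul_eq_zero.1 hdQ).resolve_right hQ
    refine hν0 ?_
    ext i
    have := hl' i
    rw [hd0] at this
    fin_cases i <;> simpa [minkowskiSign] using this
  have key : ∀ v, hessianForm (fun t => minkowski (x t - x u) ν) u v v *
      minkowski (P u) (P u) ^ 2 = -l * contactForm p₀ (P u) (fderiv ℝ P u v) := by
    intro v
    have := hessianForm_height hr.le hP2 hf hfu hf' hPS hfP hl' v v
    rw [real_inner_self_eq_norm_sq] at this
    rw [contactForm]
    linear_combination minkowski (P u) (P u) * this -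
      2 * minkowski (fderiv ℝ P u v) (fderiv ℝ P u v) * hdQ
  have hQ2 : 0 < minkowski (P u) (P u) ^ 2 := by positivity
  have hlift : ∀ e, e ≠ 0 → inner ℝ (P u - p₀) e = 0 → ∃ v, v ≠ 0 ∧ fderiv ℝ P u v = e := by
    intro e he0 he
    obtain ⟨v, rfl⟩ := hsurj e he
    exact ⟨v, fun h => he0 (by rw [h, map_zero]), rfl⟩
  rcases hdef with hdef | hdef <;> rcases lt_or_gt_of_ne hl0 with hl1 | hl1
  · refine Or.inl fun e he0 he => ?_
    obtain ⟨v, hv, rfl⟩ := hlift e he0 he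
    have := mul_pos (hdef v hv) hQ2
    rw [key] at this
    exact pos_of_mul_pos_right this (by linarith)
  · refine Or.inr fun e he0 he => ?_
    obtain ⟨v, hv, rfl⟩ := hlift e he0 he
    have := mul_pos (hdef v hv) hQ2
    rw [key] at this
    exact neg_of_mul_pos_right this (by linarith)
  · refine Or.inr fun e he0 he => ?_
    obtain ⟨v, hv, rfl⟩ := hlift e he0 he
    have := mul_neg_of_neg_of_pos (hdef v hv) hQ2
    rw [key] at this
    exact neg_of_mul_neg_right this (by linarith)
  · refine Or.inl fun e he0 he => ?_
    obtain ⟨v, hv, rfl⟩ := hlift e he0 he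
    have := mul_neg_of_neg_of_pos (hdef v hv) hQ2
    rw [key] at this
    exact pos_of_mul_neg_right this (by linarith)

/-- If the contact form is definite, then every local parametrization exhibits contact `A₁⁺`. -/
lemma HasDefiniteContactForm.hasA1PlusContact (hr : 0 < r)
    (h0 : ∀ p ∈ Metric.sphere p₀ r, minkowski p p ≠ 0)
    (hx : IsLocalParam (minkowskiInversion '' Metric.sphere p₀ r) U x) (hu : u ∈ U)
    (h : HasDefiniteContactForm p₀ (minkowskiInversion (x u))) :
    HasA1PlusContact (minkowskiInversion '' Metric.sphere p₀ r) (x u) := by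
  obtain ⟨hxc, hPc, hPS, hx0, htan, hinj, -⟩ := hx.inverse_param hr h0 hu
  have hP2 := hPc.of_le (m := 2) ENat.LEInfty.out
  have hQ := h0 _ hPS.self_of_nhds
  have hxinv := minkowskiInversion_minkowskiInversion hx0.self_of_nhds
  set P := fun t => minkowskiInversion (x t)
  have hn : P u - p₀ ≠ 0 := by
    rw [← norm_pos_iff, mem_sphere_iff_norm.1 hPS.self_of_nhds]
    exact hr
  change HasDefiniteContactForm p₀ (P u) at h
  change minkowskiInversion (P u) = x u at hxinv
  -- The pair `(ν, d)` solves the equations of `hessianForm_height` with `l = -1`.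
  set d : ℝ := inner ℝ (P u) (P u - p₀) / minkowski (P u) (P u)
  have hdQ : d * minkowski (P u) (P u) = inner ℝ (P u) (P u - p₀) := div_mul_cancel₀ _ hQ
  set ν : R3 := WithLp.toLp 2 fun i => 2 * d * P u i - minkowskiSign i * (P u i - p₀ i)
  have hνP : minkowski (P u) ν = d * minkowski (P u) (P u) := by
    rw [inner_fin_three] at hdQ
    simp only [PiLp.sub_apply] at hdQ
    simp [minkowski, ν, minkowskiSign] at hdQ ⊢
    linear_combination hdQ
  have hdν : minkowski (x u) ν = d := by
    have : minkowski (x u) ν = (minkowski (P u) (P u))⁻¹ * minkowski (P u) ν := by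
      rw [← hxinv]
      simp [minkowskiInversion, minkowski]
      ring
    rw [this, hνP, mul_comm d, inv_mul_cancel_left₀ hQ]
  have hν0 : ν ≠ 0 := by
    intro h1
    have h2 : d = 0 := by
      have : minkowski (P u) ν = 0 := by simp [h1, minkowski]
      rw [hνP] at this
      exact (mul_eq_zero.1 this).resolve_right hQ
    refine hn ?_
    ext i
    have := congrArg (fun y : R3 => y i) h1
    simp only [ν, h2] at this
    fin_cases i <;> simp [minkowskiSign] at this ⊢ <;> linarith
  have hf := contDiffAt_height (q := x u) (ν := ν) hxc
  have hfP : ∀ᶠ t in 𝓝 u, _ := Eventually.of_forall fun t =>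
    height_eq (x := x) (t := t) (q := x u) (ν := ν)
  rw [hdν] at hfP
  have hfu : minkowski (x u - x u) ν = 0 := by simp [minkowski]
  have hl' : ∀ i, minkowskiSign i * (ν i - 2 * d * P u i) = (-1) * (P u i - p₀ i) := by
    intro i
    fin_cases i <;> simp [ν, minkowskiSign]
  have hf' : fderiv ℝ (fun t => minkowski (x t - x u) ν) u = 0 := by
    ext v
    have := fderiv_height hP2 hf hfu hfP v
    have h2 := htan v
    rw [inner_fin_three] at h2
    simp only [hl', Fin.sum_univ_three] at this
    refine (mul_eq_zero.1 (this.trans ?_)).resolve_right hQ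
    simp only [PiLp.sub_apply] at h2
    linear_combination -h2
  have key : ∀ v, hessianForm (fun t => minkowski (x t - x u) ν) u v v *
      minkowski (P u) (P u) ^ 2 = contactForm p₀ (P u) (fderiv ℝ P u v) := by
    intro v
    have := hessianForm_height hr.le hP2 hf hfu hf' hPS hfP hl' v v
    rw [real_inner_self_eq_norm_sq] at this
    rw [contactForm]
    linear_combination minkowski (P u) (P u) * this -
      2 * minkowski (fderiv ℝ P u v) (fderiv ℝ P u v) * hdQ
  have hQ2 : 0 < minkowski (P u) (P u) ^ 2 := by positivity
  have hne : ∀ v, v ≠ 0 → fderiv ℝ P u v ≠ 0 := fun v hv h => hv (hinj (h.trans (map_zero _).symm))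
  obtain ⟨hM, hI⟩ := (isMorseSingularity_and_index_iff hf).2 ⟨hf', h.imp
    (fun h v hv => by
      have := h _ (hne v hv) (htan v)
      rw [← key] at this
      exact pos_of_mul_pos_left this hQ2.le)
    (fun h v hv => by
      have := h _ (hne v hv) (htan v)
      rw [← key] at this
      exact neg_of_mul_neg_left this hQ2.le)⟩
  refine ⟨U, x, u, ν, hx, hu, rfl, hν0, fun v => ?_, hM, hI⟩
  have hd' := hxc.differentiableAt (by simp)
  have h1 : HasFDerivAt (fun t => minkowski (x t - x u) ν)
      (ν 0 • fderiv ℝ (fun t => x t 0) u + ν 1 • fderiv ℝ (fun t => x t 1) u -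
        ν 2 • fderiv ℝ (fun t => x t 2) u) u := by
    have hc (i : Fin 3) := ((contDiffAt_coord hxc i).differentiableAt (by simp)).hasFDerivAt
    have hc' (i : Fin 3) : HasFDerivAt (fun t => (x t - x u) i * ν i)
        (ν i • fderiv ℝ (fun t => x t i) u) u := ((hc i).sub_const _).mul_const _
    exact ((hc' 0).add (hc' 1)).sub (hc' 2)
  rw [h1.fderiv] at hf'
  have := congrArg (fun T : R2 →L[ℝ] ℝ => T v) hf'
  simp only [sub_apply, add_apply, smul_apply, smul_eq_mul, fderiv_coord hd', zero_apply] at this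
  rw [minkowski]
  linarith

end LocalParam

/-! ### Local parametrizations of an inverted sphere -/

/-- Around `p₀ + r b₂` the sphere is the graph of `√(1 - |t|²)` over the disc `|t| < 1` in the
plane spanned by `b₀` and `b₁`; the scaled coordinates along `b₀` and `b₁` invert this
parametrization, and composition with the inversion preserves all properties of a chart. -/
lemma isRegularSurface_image_minkowskiInversion {p₀ : R3} {r : ℝ} (hr : 0 < r)
    (h0 : ∀ p ∈ Metric.sphere p₀ r, minkowski p p ≠ 0) :
    IsRegularSurface (minkowskiInversion '' Metric.sphere p₀ r) := by
  rintro _ ⟨p, hp, rfl⟩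
  have hpn : ‖p - p₀‖ = r := mem_sphere_iff_norm.1 hp
  obtain ⟨b, hb⟩ : ∃ b : OrthonormalBasis (Fin 3) ℝ R3, b 2 = r⁻¹ • (p - p₀) := by
    have hs : Orthonormal ℝ (({2} : Set (Fin 3)).domRestrict fun _ => r⁻¹ • (p - p₀)) := by
      constructor
      · intro i
        show ‖r⁻¹ • (p - p₀)‖ = 1
        rw [norm_smul, hpn, norm_inv, Real.norm_of_nonneg hr.le, inv_mul_cancel₀ hr.ne']
      · intro i j hij
        exact absurd (Subsingleton.elim i j) hij
    obtain ⟨b, hb⟩ := hs.exists_orthonormalBasis_extension_of_card_eq (by simp [R3])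
    exact ⟨b, hb 2 rfl⟩
  set w : R2 → R3 := fun t => !₂[r * t 0, r * t 1, r * √(1 - t 0 ^ 2 - t 1 ^ 2)]
  set φ : R2 → R3 := fun t => p₀ + b.repr.symm (w t)
  set L : R3 → R2 := fun q => !₂[r⁻¹ * b.repr (q - p₀) 0, r⁻¹ * b.repr (q - p₀) 1]
  set U : Set R2 := {t | 0 < 1 - t 0 ^ 2 - t 1 ^ 2}
  set V : Set R3 := {q | minkowski q q ≠ 0} ∩
    minkowskiInversion ⁻¹' {q | 0 < b.repr (q - p₀) 2}
  have hUo : IsOpen U := isOpen_lt (by fun_prop) (by fun_prop)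
  have hQo : IsOpen {q : R3 | minkowski q q ≠ 0} :=
    isOpen_ne_fun continuous_minkowski_self continuous_const
  have hιc : ContinuousOn minkowskiInversion {q | minkowski q q ≠ 0} := fun q hq =>
    (contDiffAt_minkowskiInversion hq).continuousAt.continuousWithinAt
  have hVo : IsOpen V := hιc.isOpen_inter_preimage hQo
    (isOpen_lt (by fun_prop) (by fun_prop))
  have hLd : Differentiable ℝ L := by
    rw [differentiable_euclidean]
    intro i
    have h1 : Differentiable ℝ fun q : R3 => b.repr (q - p₀) :=
      b.repr.toContinuousLinearEquiv.differentiable.comp (differentiable_id.sub_const p₀)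
    have h2 := differentiable_euclidean.1 h1
    fin_cases i
    · exact (h2 0).const_mul _
    · exact (h2 1).const_mul _
  have hLφ : ∀ t, L (φ t) = t := by
    intro t
    ext i
    fin_cases i <;> simp [L, φ, w, hr.ne']
  have hφS : ∀ t ∈ U, φ t ∈ Metric.sphere p₀ r := by
    intro t ht
    rw [mem_sphere_iff_norm, ← sq_eq_sq₀ (norm_nonneg _) hr.le]
    have : φ t - p₀ = b.repr.symm (w t) := by simp [φ]
    rw [this, LinearIsometryEquiv.norm_map, norm_sq_fin_three]
    simp [w, mul_pow, Real.sq_sqrt (le_of_lt ht)]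
    ring
  have hφc : ∀ t ∈ U, ContDiffAt ℝ ∞ φ t := by
    intro t ht
    have h1 : ContDiffAt ℝ ∞ w t := by
      rw [contDiffAt_euclidean]
      have h2 : ContDiffAt ℝ ∞ (fun t : R2 => √(1 - t 0 ^ 2 - t 1 ^ 2)) t :=
        ContDiffAt.sqrt (by fun_prop) (ne_of_gt ht)
      intro i
      fin_cases i
      · show ContDiffAt ℝ ∞ (fun t : R2 => r * t 0) t
        fun_prop
      · show ContDiffAt ℝ ∞ (fun t : R2 => r * t 1) t
        fun_prop
      · exact contDiffAt_const.mul h2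
    exact contDiffAt_const.add
      (b.repr.symm.toContinuousLinearEquiv.contDiff.contDiffAt.comp t h1)
  have hιφ : ∀ t ∈ U, minkowskiInversion (minkowskiInversion (φ t)) = φ t := fun t ht =>
    minkowskiInversion_minkowskiInversion (h0 _ (hφS t ht))
  have hxQ : ∀ t ∈ U, minkowski (minkowskiInversion (φ t)) (minkowskiInversion (φ t)) ≠ 0 := by
    intro t ht
    rw [minkowski_minkowskiInversion]
    exact inv_ne_zero (h0 _ (hφS t ht))
  have hxc : ∀ t ∈ U, ContDiffAt ℝ ∞ (fun t => minkowskiInversion (φ t)) t := fun t ht =>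
    (contDiffAt_minkowskiInversion (h0 _ (hφS t ht))).comp t (hφc t ht)
  have himg : (fun t => minkowskiInversion (φ t)) '' U =
      minkowskiInversion '' Metric.sphere p₀ r ∩ V := by
    ext q
    constructor
    · rintro ⟨t, ht, rfl⟩
      refine ⟨⟨_, hφS t ht, rfl⟩, hxQ t ht, ?_⟩
      show 0 < b.repr (minkowskiInversion (minkowskiInversion (φ t)) - p₀) 2
      rw [hιφ t ht]
      have : 0 < √(1 - t 0 ^ 2 - t 1 ^ 2) := Real.sqrt_pos.2 ht
      simpa [φ, w] using mul_pos hr this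
    · rintro ⟨hq, hq0, hq2⟩
      obtain ⟨-, hqS⟩ := (mem_image_minkowskiInversion_iff h0).1 hq
      set y := b.repr (minkowskiInversion q - p₀) with hy
      have hy2 : 0 < y 2 := hq2
      have hyr : y 0 ^ 2 + y 1 ^ 2 + y 2 ^ 2 = r ^ 2 := by
        rw [← norm_sq_fin_three, hy, LinearIsometryEquiv.norm_map, mem_sphere_iff_norm.1 hqS]
      have hE : 1 - (r⁻¹ * y 0) ^ 2 - (r⁻¹ * y 1) ^ 2 = (r⁻¹ * y 2) ^ 2 := by
        field_simp
        linarith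
      refine ⟨L (minkowskiInversion q), ?_, ?_⟩
      · show 0 < 1 - (r⁻¹ * y 0) ^ 2 - (r⁻¹ * y 1) ^ 2
        rw [hE]
        positivity
      · have hwy : w (L (minkowskiInversion q)) = y := by
          ext i
          fin_cases i
          · show r * (r⁻¹ * y 0) = y 0
            rw [mul_inv_cancel_left₀ hr.ne']
          · show r * (r⁻¹ * y 1) = y 1
            rw [mul_inv_cancel_left₀ hr.ne']
          · show r * √(1 - (r⁻¹ * y 0) ^ 2 - (r⁻¹ * y 1) ^ 2) = y 2
            rw [hE, Real.sqrt_sq (by positivity), mul_inv_cancel_left₀ hr.ne']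
        have : φ (L (minkowskiInversion q)) = minkowskiInversion q := by
          simp [φ, hwy, y]
        show minkowskiInversion (φ (L (minkowskiInversion q))) = q
        rw [this, minkowskiInversion_minkowskiInversion hq0]
  refine ⟨U, fun t => minkowskiInversion (φ t), ⟨hUo, fun t ht => (hxc t ht).contDiffWithinAt,
    fun t ht => ?_, ?_, V, hVo, himg⟩, ?_⟩
  · -- The differential has a left inverse, the differential of `L ∘ minkowskiInversion`.
    have h1 : (L ∘ minkowskiInversion) ∘ (fun t => minkowskiInversion (φ t)) =ᶠ[𝓝 t] id := by
      filter_upwards [hUo.mem_nhds ht] with s hs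
      show L (minkowskiInversion (minkowskiInversion (φ s))) = s
      rw [hιφ s hs, hLφ]
    have h2 := h1.fderiv_eq (𝕜 := ℝ)
    rw [fderiv_comp t ((hLd _).comp _ ((contDiffAt_minkowskiInversion
      (hxQ t ht)).differentiableAt (by simp))) ((hxc t ht).differentiableAt (by simp)),
      fderiv_id] at h2
    intro v v' hvv
    have h3 := congrArg (fun T : R2 →L[ℝ] R2 => T v) h2
    have h4 := congrArg (fun T : R2 →L[ℝ] R2 => T v') h2
    simp only [ContinuousLinearMap.comp_apply, ContinuousLinearMap.id_apply] at h3 h4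
    rw [← h3, hvv, h4]
  · set f : U → {q : R3 | minkowski q q ≠ 0} := fun t => ⟨minkowskiInversion (φ t), hxQ t t.2⟩
    have hf : Continuous f := Continuous.subtype_mk
      (ContinuousOn.domRestrict fun t ht => (hxc t ht).continuousAt.continuousWithinAt) _
    set g : {q : R3 | minkowski q q ≠ 0} → R2 := fun q => L (minkowskiInversion q)
    have hg : Continuous g := hLd.continuous.comp hιc.domRestrict
    have hgf : g ∘ f = Subtype.val := by
      ext1 t
      show L (minkowskiInversion (minkowskiInversion (φ t))) = t
      rw [hιφ t t.2, hLφ]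
    exact IsEmbedding.subtypeVal.comp
      (IsEmbedding.of_comp hf hg (hgf ▸ IsEmbedding.subtypeVal))
  · rw [himg]
    refine ⟨⟨p, hp, rfl⟩, ?_, ?_⟩
    · show minkowski (minkowskiInversion p) (minkowskiInversion p) ≠ 0
      rw [minkowski_minkowskiInversion]
      exact inv_ne_zero (h0 p hp)
    · show 0 < b.repr (minkowskiInversion (minkowskiInversion p) - p₀) 2
      rw [minkowskiInversion_minkowskiInversion (h0 p hp), b.repr_apply_apply, hb,
        real_inner_smul_left, real_inner_self_eq_norm_sq, hpn]
      positivity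

/-- Compactness of the inverse accounts for the condition that the sphere misses the light cone,
contact `A₁⁺` for the definiteness of the contact form. -/
lemma isOvaloid_mobiusInversion_sphere_iff {p₀ : R3} {r : ℝ} (hr : 0 < r) :
    IsOvaloid (mobiusInversion (Metric.sphere p₀ r)) ↔
      ∀ p ∈ Metric.sphere p₀ r, minkowski p p ≠ 0 ∧ HasDefiniteContactForm p₀ p := by
  constructor
  · intro h
    have h0 := minkowski_ne_zero_of_isCompact hr h.compact
    intro p hp
    have hc := h.contact
    rw [mobiusInversion_sphere_eq_image h0] at hc
    have := (hc _ ⟨p, hp, rfl⟩).hasDefiniteContactForm hr h0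
    rw [minkowskiInversion_minkowskiInversion (h0 p hp)] at this
    exact ⟨h0 p hp, this⟩
  · intro h
    have h0 : ∀ p ∈ Metric.sphere p₀ r, minkowski p p ≠ 0 := fun p hp => (h p hp).1
    have hreg := isRegularSurface_image_minkowskiInversion hr h0
    rw [mobiusInversion_sphere_eq_image h0]
    refine ⟨hreg, isCompact_image_minkowskiInversion h0, (isConnected_sphere_R3 p₀ hr.le).image _
      fun p hp => (contDiffAt_minkowskiInversion (h0 p hp)).continuousAt.continuousWithinAt,
      fun q hq => ?_⟩
    obtain ⟨U, x, hx, u, hu, rfl⟩ := hreg q hq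
    exact HasDefiniteContactForm.hasA1PlusContact hr h0 hx hu
      (h _ ((mem_image_minkowskiInversion_iff h0).1 hq).2).2

/-! ### Sign of the contact form -/

/-- Bound for the vertical component of a vector tangent to a sphere. -/
lemma vertical_sq_mul_le {e y : R3} (h : inner ℝ y e = 0) :
    e 2 ^ 2 * ‖y‖ ^ 2 ≤ (‖y‖ ^ 2 - y 2 ^ 2) * ‖e‖ ^ 2 := by
  rw [inner_fin_three] at h
  rw [norm_sq_fin_three, norm_sq_fin_three]
  have h1 : (e 2 * y 2) ^ 2 = (e 0 * y 0 + e 1 * y 1) ^ 2 := by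
    have : e 2 * y 2 = -(e 0 * y 0 + e 1 * y 1) := by linarith
    rw [this, neg_sq]
  nlinarith [sq_nonneg (e 0 * y 1 - e 1 * y 0)]

/-- A function of `τ` that is affine and positive at both ends of an interval is positive inside,
written homogeneously. -/
lemma affine_pos {X D N τ k r : ℝ} (hr : 0 < r) (hX : 0 < X)
    (hY : 0 < r ^ 2 * X + 4 * D * k) (hN : 0 < N) (hτ : 0 ≤ τ) (hτk : τ * r ^ 2 ≤ k * N) :
    0 < X * N + 4 * D * τ := by
  have hXN := mul_pos hX hN
  rcases le_or_gt 0 D with hD | hD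
  · have := mul_nonneg hD hτ
    linarith
  · have h1 : D * (k * N) ≤ D * (τ * r ^ 2) := mul_le_mul_of_nonpos_left hτk hD.le
    have h2 := mul_pos hY hN
    have h3 : 0 < r ^ 2 * (X * N + 4 * D * τ) := by linarith
    exact pos_of_mul_pos_right h3 (by positivity)

lemma contactForm_eq (p₀ p e : R3) : contactForm p₀ p e =
    (minkowski p p - 2 * inner ℝ p (p - p₀)) * ‖e‖ ^ 2 + 4 * inner ℝ p (p - p₀) * e 2 ^ 2 := by
  have : minkowski e e = ‖e‖ ^ 2 - 2 * e 2 ^ 2 := by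
    rw [norm_sq_fin_three, minkowski]
    ring
  rw [contactForm, this]
  ring

/-- Positivity of the contact form follows from its values on a horizontal tangent vector and on
a steepest one. -/
lemma contactForm_pos {p₀ p e : R3} {r : ℝ} (hr : 0 < r) (hp : p ∈ Metric.sphere p₀ r)
    (he0 : e ≠ 0) (he : inner ℝ (p - p₀) e = 0)
    (hX : 0 < minkowski p p - 2 * inner ℝ p (p - p₀))
    (hY : 0 < r ^ 2 * (minkowski p p - 2 * inner ℝ p (p - p₀)) +
      4 * inner ℝ p (p - p₀) * (r ^ 2 - (p 2 - p₀ 2) ^ 2)) : 0 < contactForm p₀ p e := by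
  have h := vertical_sq_mul_le he
  rw [mem_sphere_iff_norm.1 hp, PiLp.sub_apply] at h
  rw [contactForm_eq]
  exact affine_pos hr hX hY (by positivity) (sq_nonneg _) h

lemma contactForm_neg {p₀ p e : R3} {r : ℝ} (hr : 0 < r) (hp : p ∈ Metric.sphere p₀ r)
    (he0 : e ≠ 0) (he : inner ℝ (p - p₀) e = 0)
    (hX : minkowski p p - 2 * inner ℝ p (p - p₀) < 0)
    (hY : r ^ 2 * (minkowski p p - 2 * inner ℝ p (p - p₀)) +
      4 * inner ℝ p (p - p₀) * (r ^ 2 - (p 2 - p₀ 2) ^ 2) < 0) : contactForm p₀ p e < 0 := by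
  have h := vertical_sq_mul_le he
  rw [mem_sphere_iff_norm.1 hp, PiLp.sub_apply] at h
  rw [contactForm_eq]
  have := affine_pos (X := -(minkowski p p - 2 * inner ℝ p (p - p₀))) (D := -inner ℝ p (p - p₀))
    (N := ‖e‖ ^ 2) hr (by linarith) (by linarith) (by positivity) (sq_nonneg _) h
  linarith

/-- The value of the contact form on a steepest tangent vector is bounded below by this function
of the slope. It is smallest at `k = r`, `s = 0`, where it has the factor
`(R - 2r)² - (C² + r²)`. -/
lemma steepest_value_pos {r k s C R : ℝ} (hr : 0 < r)
    (hks : k ^ 2 + s ^ 2 = r ^ 2) (hC : 0 ≤ C) (hCR : C + 2 * r ≤ R)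
    (h : 0 < R ^ 2 - 4 * r * R + 3 * r ^ 2 - C ^ 2) :
    0 < r ^ 2 * (R ^ 2 - C ^ 2) - 4 * R * k ^ 3 - 4 * C * s ^ 3 + 3 * r ^ 4 -
      6 * r ^ 2 * s ^ 2 := by
  have hkr : k ≤ r := abs_le_of_sq_le_sq' (by nlinarith) hr.le |>.2
  have hsr : s ≤ r := abs_le_of_sq_le_sq' (by nlinarith) hr.le |>.2
  have h1 : k ^ 3 ≤ r * k ^ 2 := by
    rw [pow_succ' k 2]
    exact mul_le_mul_of_nonneg_right hkr (sq_nonneg _)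
  have h2 : s ^ 3 ≤ r * s ^ 2 := by
    rw [pow_succ' s 2]
    exact mul_le_mul_of_nonneg_right hsr (sq_nonneg _)
  have h3 : r * k ^ 2 = r ^ 3 - r * s ^ 2 := by linear_combination r * hks
  have h4 : r * s ^ 2 ≤ r ^ 3 - k ^ 3 := by linarith
  have h5 : (C + 2 * r) * (r ^ 3 - k ^ 3) ≤ R * (r ^ 3 - k ^ 3) :=
    mul_le_mul_of_nonneg_right hCR (le_trans (by positivity) h4)
  have h6 : C * s ^ 3 ≤ C * (r ^ 3 - k ^ 3) := mul_le_mul_of_nonneg_left (h2.trans h4) hC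
  have h7 : r * (r * s ^ 2) ≤ r * (r ^ 3 - k ^ 3) := mul_le_mul_of_nonneg_left h4 hr.le
  have h8 : 0 < r ^ 2 * (R ^ 2 - 4 * r * R + 3 * r ^ 2 - C ^ 2) := by positivity
  have h9 : 0 ≤ r ^ 2 * s ^ 2 := by positivity
  linarith

section Center

variable {a b c r : ℝ} {p : R3}

/-- Coordinates of a point of the sphere relative to its center, with the bounds on which all
estimates rest. -/
lemma exists_relative_coordinates (hr : 0 < r) (hp : p ∈ Metric.sphere (!₂[a, b, c] : R3) r) :
    ∃ m k z : ℝ, 0 ≤ k ∧ k ^ 2 + z ^ 2 = r ^ 2 ∧ |m| ≤ √(a ^ 2 + b ^ 2) * k ∧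
      p 2 - (!₂[a, b, c] : R3) 2 = z ∧
      minkowski p p = a ^ 2 + b ^ 2 - c ^ 2 + 2 * (m - c * z) + (k ^ 2 - z ^ 2) ∧
      inner ℝ p (p - !₂[a, b, c]) = m + c * z + r ^ 2 := by
  have h := (mem_sphere_iff_coord hr.le).1 hp
  simp at h
  have hk : 0 ≤ (p 0 - a) ^ 2 + (p 1 - b) ^ 2 := by positivity
  refine ⟨a * (p 0 - a) + b * (p 1 - b), √((p 0 - a) ^ 2 + (p 1 - b) ^ 2), p 2 - c,
    Real.sqrt_nonneg _, ?_, ?_, ?_, ?_, ?_⟩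
  · rw [Real.sq_sqrt hk]
    exact h
  · rw [← Real.sqrt_mul (by positivity)]
    refine Real.abs_le_sqrt ?_
    nlinarith [sq_nonneg (a * (p 1 - b) - b * (p 0 - a))]
  · simp
  · rw [Real.sq_sqrt hk, minkowski]
    ring
  · rw [inner_fin_three, ← h]
    simp
    ring

/-- The sufficient condition for centers outside the light cone. -/
lemma hasDefiniteContactForm_of_spacelike (hr : 0 < r)
    (h : 2 * r + √(c ^ 2 + r ^ 2) < √(a ^ 2 + b ^ 2))
    (hp : p ∈ Metric.sphere (!₂[a, b, c] : R3) r) :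
    minkowski p p ≠ 0 ∧ HasDefiniteContactForm !₂[a, b, c] p := by
  obtain ⟨m, k, z, hk, hkz, hm, hz, hQ, hD⟩ := exists_relative_coordinates hr hp
  have hR2 : √(a ^ 2 + b ^ 2) ^ 2 = a ^ 2 + b ^ 2 := Real.sq_sqrt (by positivity)
  set R := √(a ^ 2 + b ^ 2)
  have hC2 : |c| ^ 2 = c ^ 2 := sq_abs c
  have hCsq : |c| ≤ √(c ^ 2 + r ^ 2) := Real.abs_le_sqrt (by nlinarith)
  have hsq : c ^ 2 + r ^ 2 < (R - 2 * r) ^ 2 :=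
    (Real.sqrt_lt' (by linarith [abs_nonneg c])).1 (by linarith)
  have hz2 : |z| ^ 2 = z ^ 2 := sq_abs z
  have hkr : k ≤ r := abs_le_of_sq_le_sq' (by nlinarith) hr.le |>.2
  have hzr : |z| ≤ r := abs_le_of_sq_le_sq' (by nlinarith [sq_nonneg k]) hr.le |>.2
  have hcz : |c * z| = |c| * |z| := abs_mul c z
  have hczr : |c| * |z| ≤ |c| * r := mul_le_mul_of_nonneg_left hzr (abs_nonneg c)
  have hCR : |c| + 2 * r < R := by linarith
  have hC0 := abs_nonneg c
  have hz0 := abs_nonneg z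
  have hcz1 := (abs_le.1 hcz.le).1
  have hcz2 := (abs_le.1 hcz.le).2
  have hm1 := (abs_le.1 hm).1
  have hX : 0 < minkowski p p - 2 * inner ℝ p (p - !₂[a, b, c]) := by
    rw [hQ, hD]
    have : (|c| + 2 * r) ^ 2 < R ^ 2 := by gcongr
    have : 0 < r ^ 2 := by positivity
    nlinarith
  have hY : 0 < r ^ 2 * (minkowski p p - 2 * inner ℝ p (p - !₂[a, b, c])) +
      4 * inner ℝ p (p - !₂[a, b, c]) * (r ^ 2 - (p 2 - (!₂[a, b, c] : R3) 2) ^ 2) := by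
    rw [hQ, hD, hz]
    have h1 := steepest_value_pos (k := k) (s := |z|) hr (by rw [hz2, hkz]) hC0 hCR.le
      (by nlinarith)
    have h2 : -(R * k) * k ^ 2 ≤ m * k ^ 2 := mul_le_mul_of_nonneg_right hm1 (sq_nonneg _)
    have h3 : (c * z) * z ^ 2 ≤ (|c| * |z|) * z ^ 2 := mul_le_mul_of_nonneg_right hcz2 (sq_nonneg _)
    have h4 : |c| * |z| ^ 3 = (|c| * |z|) * z ^ 2 := by
      rw [← hz2]
      ring
    have h5 : z ^ 2 = r ^ 2 - k ^ 2 := by linarith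
    rw [hz2, mul_assoc 4 |c|, h4, hC2, hR2] at h1
    have h6 : r ^ 2 * (a ^ 2 + b ^ 2 - c ^ 2 + 2 * (m - c * z) + (k ^ 2 - z ^ 2) -
        2 * (m + c * z + r ^ 2)) + 4 * (m + c * z + r ^ 2) * (r ^ 2 - z ^ 2) =
        r ^ 2 * (a ^ 2 + b ^ 2 - c ^ 2) + 4 * (m * k ^ 2) - 4 * (c * z * z ^ 2) + 3 * r ^ 4 -
          6 * r ^ 2 * z ^ 2 := by
      rw [show k ^ 2 = r ^ 2 - z ^ 2 by linarith]
      ring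
    rw [h6]
    linarith
  refine ⟨ne_of_gt ?_, Or.inl fun e he0 he => contactForm_pos hr hp he0 he hX hY⟩
  have h1 : (|c| + |z|) ^ 2 < (R - k) ^ 2 := by
    have : |c| + |z| < R - k := by linarith
    gcongr
  rw [hQ]
  nlinarith

/-- The sufficient condition for centers inside the light cone. -/
lemma hasDefiniteContactForm_of_timelike (hr : 0 < r)
    (h : 2 * r + √(a ^ 2 + b ^ 2 + r ^ 2) < |c|)
    (hp : p ∈ Metric.sphere (!₂[a, b, c] : R3) r) :
    minkowski p p ≠ 0 ∧ HasDefiniteContactForm !₂[a, b, c] p := by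
  obtain ⟨m, k, z, hk, hkz, hm, hz, hQ, hD⟩ := exists_relative_coordinates hr hp
  have hR2 : √(a ^ 2 + b ^ 2) ^ 2 = a ^ 2 + b ^ 2 := Real.sq_sqrt (by positivity)
  have hRsq : √(a ^ 2 + b ^ 2) ≤ √(a ^ 2 + b ^ 2 + r ^ 2) := Real.sqrt_le_sqrt (by nlinarith)
  have hR0 : 0 ≤ √(a ^ 2 + b ^ 2) := Real.sqrt_nonneg _
  set R := √(a ^ 2 + b ^ 2)
  have hC2 : |c| ^ 2 = c ^ 2 := sq_abs c
  have hsq : a ^ 2 + b ^ 2 + r ^ 2 < (|c| - 2 * r) ^ 2 :=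
    (Real.sqrt_lt' (by linarith)).1 (by linarith)
  have hz2 : |z| ^ 2 = z ^ 2 := sq_abs z
  have hkr : k ≤ r := abs_le_of_sq_le_sq' (by nlinarith) hr.le |>.2
  have hzr : |z| ≤ r := abs_le_of_sq_le_sq' (by nlinarith [sq_nonneg k]) hr.le |>.2
  have hcz : |c * z| = |c| * |z| := abs_mul c z
  have hCR : R + 2 * r < |c| := by linarith
  have hz0 := abs_nonneg z
  have hcz1 := (abs_le.1 hcz.le).1
  have hcz2 := (abs_le.1 hcz.le).2
  have hm2 := (abs_le.1 hm).2
  have hX : minkowski p p - 2 * inner ℝ p (p - !₂[a, b, c]) < 0 := by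
    rw [hQ, hD]
    have h1 : 0 ≤ (r - |z|) * (4 * |c| - 2 * (r + |z|)) :=
      mul_nonneg (by linarith) (by linarith)
    nlinarith
  have hY : r ^ 2 * (minkowski p p - 2 * inner ℝ p (p - !₂[a, b, c])) +
      4 * inner ℝ p (p - !₂[a, b, c]) * (r ^ 2 - (p 2 - (!₂[a, b, c] : R3) 2) ^ 2) < 0 := by
    rw [hQ, hD, hz]
    have h1 := steepest_value_pos (k := |z|) (s := k) hr (by rw [hz2]; linarith) hR0 hCR.le
      (by nlinarith)
    have h2 : m * k ^ 2 ≤ R * k * k ^ 2 := mul_le_mul_of_nonneg_right hm2 (sq_nonneg _)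
    have h3 : -(|c| * |z|) * z ^ 2 ≤ (c * z) * z ^ 2 :=
      mul_le_mul_of_nonneg_right hcz1 (sq_nonneg _)
    have h4 : |c| * |z| ^ 3 = (|c| * |z|) * z ^ 2 := by
      rw [← hz2]
      ring
    rw [mul_assoc 4 |c|, h4, hC2, hR2] at h1
    have h6 : r ^ 2 * (a ^ 2 + b ^ 2 - c ^ 2 + 2 * (m - c * z) + (k ^ 2 - z ^ 2) -
        2 * (m + c * z + r ^ 2)) + 4 * (m + c * z + r ^ 2) * (r ^ 2 - z ^ 2) =
        r ^ 2 * (a ^ 2 + b ^ 2 - c ^ 2) + 4 * (m * k ^ 2) - 4 * (c * z * z ^ 2) - 3 * r ^ 4 +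
          6 * r ^ 2 * k ^ 2 := by
      rw [show z ^ 2 = r ^ 2 - k ^ 2 by linarith]
      ring
    rw [h6]
    linarith
  refine ⟨ne_of_lt ?_, Or.inr fun e he0 he => contactForm_neg hr hp he0 he hX hY⟩
  have h1 : (R + k) ^ 2 < (|c| - |z|) ^ 2 := by
    have : R + k < |c| - |z| := by linarith
    gcongr
  rw [hQ]
  nlinarith

/-- The Minkowski square has constant sign on a sphere which misses the light cone. -/
lemma minkowski_pos_or_neg {p₀ : R3} (hr : 0 < r)
    (h0 : ∀ p ∈ Metric.sphere p₀ r, minkowski p p ≠ 0) :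
    (∀ p ∈ Metric.sphere p₀ r, 0 < minkowski p p) ∨
      ∀ p ∈ Metric.sphere p₀ r, minkowski p p < 0 := by
  by_contra! h
  obtain ⟨⟨p, hp, hp0⟩, q, hq, hq0⟩ := h
  obtain ⟨y, hy, hy0⟩ := (isConnected_sphere_R3 p₀ hr.le).isPreconnected.intermediate_value hp hq
    continuous_minkowski_self.continuousOn ⟨hp0, hq0⟩
  exact h0 y hy hy0

/-- The necessary condition when the sphere lies outside the light cone. At the point of the sphere
at the height of its center nearest to the axis, the contact form is positive on a horizontal
tangent vector, so it is also positive on a vertical one. -/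
lemma spacelike_condition_of_definite (hr : 0 < r)
    (hpos : ∀ p ∈ Metric.sphere (!₂[a, b, c] : R3) r, 0 < minkowski p p)
    (hdef : ∀ p ∈ Metric.sphere (!₂[a, b, c] : R3) r, HasDefiniteContactForm !₂[a, b, c] p) :
    2 * r + √(c ^ 2 + r ^ 2) < √(a ^ 2 + b ^ 2) := by
  have hR2 : √(a ^ 2 + b ^ 2) ^ 2 = a ^ 2 + b ^ 2 := Real.sq_sqrt (by positivity)
  have hR0 : 0 ≤ √(a ^ 2 + b ^ 2) := Real.sqrt_nonneg _
  set R := √(a ^ 2 + b ^ 2)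
  have hmem (s : ℝ) (hs : s ^ 2 = r ^ 2) : 0 < a ^ 2 + b ^ 2 - (c + s) ^ 2 := by
    have := hpos !₂[a, b, c + s] ((mem_sphere_iff_coord hr.le).2 (by simpa using hs))
    simp [minkowski] at this
    linarith
  have hRc : |c| + r < R := by
    have h1 := hmem r rfl
    have h2 := hmem (-r) (by ring)
    refine Real.lt_sqrt_of_sq_lt ?_
    rcases abs_cases c with ⟨h, -⟩ | ⟨h, -⟩ <;> rw [h] <;> nlinarith
  have hC0 := abs_nonneg c
  have hRpos : 0 < R := by linarith
  set s := r / R with hs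
  have hsR : s * R = r := div_mul_cancel₀ _ hRpos.ne'
  have hab : s ^ 2 * (a ^ 2 + b ^ 2) = r ^ 2 := by rw [← hR2, ← mul_pow, hsR]
  set p : R3 := !₂[a - s * a, b - s * b, c]
  have hpS : p ∈ Metric.sphere (!₂[a, b, c] : R3) r := by
    rw [mem_sphere_iff_coord hr.le]
    simp [p]
    linarith
  have hQ : minkowski p p = (R - r) ^ 2 - c ^ 2 := by
    simp [p, minkowski]
    linear_combination (1 - 2 * s) * (-hR2) + hab - 2 * R * hsR
  have hD : inner ℝ p (p - !₂[a, b, c]) = r ^ 2 - r * R := by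
    rw [inner_fin_three]
    simp [p]
    linear_combination s * hR2 + hab - R * hsR
  have hc2 := sq_abs c
  have key : 0 < minkowski p p + 2 * inner ℝ p (p - !₂[a, b, c]) := by
    have hform (e : R3) := contactForm_eq !₂[a, b, c] p e
    have he1 := hform !₂[-b, a, 0]
    have he2 := hform !₂[0, 0, 1]
    rw [norm_sq_fin_three] at he1 he2
    simp at he1 he2
    have h1 : inner ℝ (p - !₂[a, b, c]) !₂[-b, a, 0] = 0 := by
      rw [inner_fin_three]
      simp [p]
      ring
    have h2 : inner ℝ (p - !₂[a, b, c]) !₂[0, 0, 1] = 0 := by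
      rw [inner_fin_three]
      simp [p]
    have hne2 : (!₂[0, 0, 1] : R3) ≠ 0 := fun h => by
      have := congrArg (fun y : R3 => y 2) h
      simp at this
    have hne1 : (!₂[-b, a, 0] : R3) ≠ 0 := fun h => by
      have h3 := congrArg (fun y : R3 => y 0) h
      have h4 := congrArg (fun y : R3 => y 1) h
      simp at h3 h4
      rw [h3, h4] at hR2
      nlinarith
    have hX : 0 < contactForm !₂[a, b, c] p !₂[-b, a, 0] := by
      rw [he1]
      have : 0 < minkowski p p - 2 * inner ℝ p (p - !₂[a, b, c]) := by
        rw [hQ, hD]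
        nlinarith
      refine mul_pos this ?_
      nlinarith
    rcases hdef p hpS with h | h
    · have := h _ hne2 h2
      rw [he2] at this
      linarith
    · exact absurd hX (h _ hne1 h1).not_gt
  rw [hQ, hD] at key
  have hsq : c ^ 2 + r ^ 2 < (R - 2 * r) ^ 2 := by linarith
  have hR2r : 2 * r < R := by
    by_contra! h
    -- The other root of the quadratic inequality would give `R < r`.
    have : (2 * r - R) ^ 2 < r ^ 2 := by
      have : 0 ≤ 2 * r - R := by linarith
      have : 2 * r - R < r := by linarith
      gcongr
    nlinarith [sq_nonneg c]
  have := (Real.sqrt_lt' (by linarith)).2 hsq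
  linarith

/-- The necessary condition when the sphere lies inside the light cone. On a horizontal tangent
vector, the contact form has no zero as the height decreases from that of the center to that of the
pole next to the plane `c = 0`, so it keeps its sign. -/
lemma timelike_condition_of_definite (hr : 0 < r)
    (hneg : ∀ p ∈ Metric.sphere (!₂[a, b, c] : R3) r, minkowski p p < 0)
    (hdef : ∀ p ∈ Metric.sphere (!₂[a, b, c] : R3) r, HasDefiniteContactForm !₂[a, b, c] p) :
    2 * r + √(a ^ 2 + b ^ 2 + r ^ 2) < |c| := by
  have hR2 : √(a ^ 2 + b ^ 2) ^ 2 = a ^ 2 + b ^ 2 := Real.sq_sqrt (by positivity)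
  have hR0 : 0 ≤ √(a ^ 2 + b ^ 2) := Real.sqrt_nonneg _
  set R := √(a ^ 2 + b ^ 2)
  have hc2 := sq_abs c
  have hRc : R + r < |c| := by
    obtain ⟨x, y, hxy, hm⟩ : ∃ x y : ℝ, x ^ 2 + y ^ 2 = r ^ 2 ∧ a * x + b * y = R * r := by
      rcases hR0.eq_or_lt with h | h
      · have ha : a = 0 := by nlinarith
        have hb : b = 0 := by nlinarith
        exact ⟨r, 0, by ring, by rw [ha, hb, ← h]; ring⟩
      · refine ⟨r / R * a, r / R * b, ?_, ?_⟩
        · field_simp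
          rw [hR2]
        · field_simp
          rw [hR2]
    have := hneg !₂[a + x, b + y, c] ((mem_sphere_iff_coord hr.le).2 (by simpa using hxy))
    simp [minkowski] at this
    refine abs_lt_of_sq_lt_sq' ?_ (abs_nonneg c) |>.2
    nlinarith
  set G : ℝ → ℝ := fun t => c ^ 2 - R ^ 2 - 4 * |c| * r * t + r ^ 2 + 2 * r ^ 2 * t ^ 2
  have hGne : ∀ t ∈ Set.Icc (0 : ℝ) 1, G t ≠ 0 := by
    rintro t ⟨ht0, ht1⟩ hGt
    obtain ⟨σ, hσ, hσc⟩ : ∃ σ : ℝ, σ ^ 2 = 1 ∧ c * σ = |c| := by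
      rcases abs_cases c with ⟨h, -⟩ | ⟨h, -⟩
      · exact ⟨1, by norm_num, by rw [h]; ring⟩
      · exact ⟨-1, by norm_num, by rw [h]; ring⟩
    have hk : √(1 - t ^ 2) ^ 2 = 1 - t ^ 2 := Real.sq_sqrt (by nlinarith)
    set k := √(1 - t ^ 2)
    set p : R3 := !₂[a + r * k, b, c - σ * r * t]
    have hpS : p ∈ Metric.sphere (!₂[a, b, c] : R3) r := by
      rw [mem_sphere_iff_coord hr.le]
      simp [p]
      linear_combination r ^ 2 * hk + r ^ 2 * t ^ 2 * hσ
    have h1 : inner ℝ (p - !₂[a, b, c]) !₂[0, 1, 0] = 0 := by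
      rw [inner_fin_three]
      simp [p]
    have hne : (!₂[0, 1, 0] : R3) ≠ 0 := fun h => by
      have := congrArg (fun y : R3 => y 1) h
      simp at this
    have hform : contactForm !₂[a, b, c] p !₂[0, 1, 0] = -G t := by
      rw [contactForm_eq, norm_sq_fin_three, inner_fin_three]
      simp [p, minkowski, G]
      linear_combination (-hR2) - r ^ 2 * hk - 3 * r ^ 2 * t ^ 2 * hσ + 4 * r * t * hσc
    rcases hdef p hpS with h | h
    · have := h _ hne h1
      rw [hform, hGt] at this
      norm_num at this
    · have := h _ hne h1
      rw [hform, hGt] at this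
      norm_num at this
  have hG1 : 0 < G 1 := by
    by_contra! h
    have hG0 : 0 ≤ G 0 := by
      simp only [G]
      nlinarith
    obtain ⟨t, ht, hGt⟩ := intermediate_value_Icc' zero_le_one
      (f := G) (by fun_prop) ⟨h, hG0⟩
    exact hGne t ht hGt
  simp only [G] at hG1
  have hsq : a ^ 2 + b ^ 2 + r ^ 2 < (|c| - 2 * r) ^ 2 := by linarith
  have hc2r : 2 * r < |c| := by
    by_contra! h
    -- The other root of the quadratic inequality would give `|c| < r`.
    have : (2 * r - |c|) ^ 2 < r ^ 2 := by
      have : 0 ≤ 2 * r - |c| := by linarith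
      have : 2 * r - |c| < r := by linarith
      gcongr
    nlinarith [sq_nonneg a, sq_nonneg b]
  have := (Real.sqrt_lt' (by linarith)).2 hsq
  linarith

end Center

theorem mainTheorem4 (a b c r : ℝ) (hr : 0 < r) :
    IsOvaloid (mobiusInversion (Metric.sphere (!₂[a, b, c] : R3) r)) ↔
      (√(a ^ 2 + b ^ 2) > 2 * r + √(c ^ 2 + r ^ 2) ∨
        |c| > 2 * r + √(a ^ 2 + b ^ 2 + r ^ 2)) := by
  rw [isOvaloid_mobiusInversion_sphere_iff hr]
  constructor
  · intro h
    exact (minkowski_pos_or_neg hr fun p hp => (h p hp).1).imp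
      (fun hQ => spacelike_condition_of_definite hr hQ fun p hp => (h p hp).2)
      (fun hQ => timelike_condition_of_definite hr hQ fun p hp => (h p hp).2)
  · rintro (h | h) p hp
    · exact hasDefiniteContactForm_of_spacelike hr h hp
    · exact hasDefiniteContactForm_of_timelike hr h hp
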